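/- Let $\nu$ be a measure on $\mathbb R$, $A(\eta)=\log\int e^{\eta y}\,\nu(dy)$, $\mathcal T=\{\eta:\int e^{\eta y}\,\nu(dy)<\infty\}$, and let $P_\eta(dy)=e^{\eta y-A(\eta)}\,\nu(dy)$, $\eta\in\mathcal T$, be the natural exponential family generated by $\nu$. Assume that it is non-singular, i.e. that $P_\eta$ has positive variance for every $\eta\in\mathcal T^o$ (the interior of $\mathcal T$). Its members with $\eta\in\mathcal T^o$ are then parameterized by their mean; let $M$ be the set of the means of $P_\eta$, $\eta\in\mathcal T^o$, and for $\theta,\theta'\in M$ let $d(\theta,\theta')$ be the Kullback–Leibler divergence from the member with mean $\theta$ to the member with mean $\theta'$. Consider $K$ arms with means $\theta_1,\dots,\theta_K\in M$. All rewards are independent, and the rewards of arm $i$ are distributed as the member with mean $\theta_i$. Let $\psi=(\psi_1,\dots,\psi_K)$ be a probability vector and consider a static allocation with rate $\psi$: for the budget $n$, a deterministic number $N_i(n)$ of samples is collected from each arm $i$, with $N_i(n)\ge 1$ for all large $n$ and $N_i(n)/n\to\psi_i$. Let $\theta_{n,i}$ be the sample mean of these rewards, and for $i,j$ with $\theta_i>\theta_j$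 put $$B_{i,j}(\psi_i,\psi_j)=\inf_{\tilde\theta\in M}\big\{\psi_i\, d(\tilde\theta,\theta_i)+\psi_j\, d(\tilde\theta,\theta_j)\big\}.$$ 1. For all $i,j$ with $\theta_i>\theta_j$, the probability $\mathbb P(\theta_{n,j}>\theta_{n,i})$ is positive for all large $n$, and $$\lim_{n\to\infty}-\frac1n\log\mathbb P(\theta_{n,j}>\theta_{n,i})=B_{i,j}(\psi_i,\psi_j).$$ 2. If moreover $\psi_i+\psi_j>0$, then the infimum defining $B_{i,j}(\psi_i,\psi_j)$ is attained at exactly one point of $M$. 3. Suppose that $1\le k<K$ and that $\mathcal I$ is the unique set of $k$ arms with the largest sum of means, and let $\mathcal J=[K]\setminus\mathcal I$. Then $$\lim_{n\to\infty}-\frac1n\log\mathbb P\Big(\min_{i\in\mathcal I}\theta_{n,i}\le\max_{j\in\mathcal J}\theta_{n,j}\Big)=\min_{i\in\mathcal I}\min_{j\in\mathcal J}B_{i,j}(\psi_i,\psi_j),$$ and the probability of incorrect recommendation $\mathbb P(\hat{\mathcal I}_n\ne\mathcal I)$ decays at the same exponential rate, where $\hat{\mathcal I}_n$ is a set of $k$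 arms with the largest sum of sample means, ties being broken arbitrarily (outer probability is meant if $\hat{\mathcal I}_n$ is not measurable). Both probabilities are positive for all large $n$. -/

import Mathlib

open MeasureTheory ProbabilityTheory Filter Topology

noncomputable section

/-! ### One-dimensional natural exponential families

The family has an arbitrary base measure `ν` on `ℝ` (a Lebesgue density `b(y) dy`, a counting
measure, ...). -/

/-- The natural parameter space `{η | ∫ exp (η y) dν(y) < ∞}`. -/
def naturalSpace (ν : Measure ℝ) : Set ℝ :=
  {η | Integrable (fun y : ℝ => Real.exp (η * y)) ν}

/-- The member with natural parameter `η`, whose density with respect to `ν` is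
`exp (η y - A η)`, where `A η = log ∫ exp (η y) dν(y)`. -/
def expMember (ν : Measure ℝ) (η : ℝ) : Measure ℝ :=
  ν.tilted (fun y => η * y)

/-- The mean of the member with natural parameter `η`. -/
def meanOf (ν : Measure ℝ) (η : ℝ) : ℝ :=
  ∫ y, y ∂(expMember ν η)

/-- The family is non-singular: the variance is positive at every interior parameter. -/
def NonSingular (ν : Measure ℝ) : Prop :=
  ∀ η ∈ interior (naturalSpace ν), 0 < variance (fun y : ℝ => y) (expMember ν η)

/-- The set of means of the family (over the interior of the natural parameter space). -/
def meanSpace (ν : Measure ℝ) : Set ℝ :=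
  meanOf ν '' interior (naturalSpace ν)

/-- The natural parameter `η(θ)` of the member with mean `θ`; it is unique for `θ ∈ meanSpace ν`
when the family is non-singular. -/
def paramOf (ν : Measure ℝ) (θ : ℝ) : ℝ :=
  Function.invFunOn (meanOf ν) (interior (naturalSpace ν)) θ

/-- The member of the family with mean `θ`. -/
def memberOfMean (ν : Measure ℝ) (θ : ℝ) : Measure ℝ :=
  expMember ν (paramOf ν θ)

/-- `d(θ₁, θ₂)`: Kullback-Leibler divergence from the member with mean `θ₁` to the member with
mean `θ₂` (it is finite on `meanSpace ν`, so that `toReal` loses nothing there). -/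
def klMean (ν : Measure ℝ) (θ₁ θ₂ : ℝ) : ℝ :=
  (InformationTheory.klDiv (memberOfMean ν θ₁) (memberOfMean ν θ₂)).toReal

/-- `ψ₁ d(x, θ₁) + ψ₂ d(x, θ₂)`. -/
def pairCost (ν : Measure ℝ) (ψ₁ ψ₂ θ₁ θ₂ x : ℝ) : ℝ :=
  ψ₁ * klMean ν x θ₁ + ψ₂ * klMean ν x θ₂

/-- `B = inf_x ψ₁ d(x, θ₁) + ψ₂ d(x, θ₂)`, over all means `x` of the family. -/
def pairRate (ν : Measure ℝ) (ψ₁ ψ₂ θ₁ θ₂ : ℝ) : ℝ :=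
  sInf (pairCost ν ψ₁ ψ₂ θ₁ θ₂ '' meanSpace ν)

/-! ### The bandit -/

/-- The vector of the sample means when `m i` rewards of each arm `i` have been collected. -/
def sampleMeans {K : ℕ} {Ω : Type*} (Y : Fin K → ℕ → Ω → ℝ) (m : Fin K → ℕ) (ω : Ω) :
    Fin K → ℝ :=
  fun i => (∑ s ∈ Finset.range (m i), Y i s ω) / (m i : ℝ)

/-- The joint distribution of the vector of the sample means. -/
def sampleMeansLaw {K : ℕ} {Ω : Type*} [MeasurableSpace Ω] (μ : Measure Ω)
    (Y : Fin K → ℕ → Ω → ℝ) (m : Fin K → ℕ) : Measure (Fin K → ℝ) :=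
  μ.map (sampleMeans Y m)

/-- `S` maximizes `∑ i ∈ S, x i` among the sets of `k` arms. -/
def IsTopSet {K : ℕ} (k : ℕ) (x : Fin K → ℝ) (S : Finset (Fin K)) : Prop :=
  S.card = k ∧ ∀ S' : Finset (Fin K), S'.card = k → ∑ i ∈ S', x i ≤ ∑ i ∈ S, x i

/-- The vectors for which every arm of `I` is strictly better than every other arm. -/
def topRegion {K : ℕ} (I : Finset (Fin K)) : Set (Fin K → ℝ) :=
  {x | ∀ i ∈ I, ∀ j ∈ Iᶜ, x j < x i}

/-- The sequence `p` of probabilities is eventually positive and `-(1/n) log (p n) → r`. -/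
def HasDecayRate (p : ℕ → ℝ) (r : ℝ) : Prop :=
  (∀ᶠ n in atTop, 0 < p n) ∧
    Tendsto (fun n : ℕ => -(1 / (n : ℝ)) * Real.log (p n)) atTop (𝓝 r)

end

/-! ### Lower bounds for sums of independent identically distributed variables -/

section Iid

variable {Ω : Type*} [MeasurableSpace Ω] {μ : Measure Ω} {X : ℕ → Ω → ℝ}

/-! Tilting one member of the family gives another, so each divergence is an explicit expression in
the log-partition function (`toReal_klDiv_expMember`). The weighted sum of divergences to `η₁` and
`η₂` is a constant, `pairExponent`, plus the total weight times the divergence to the weighted mean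
of `η₁` and `η₂` (`weighted_klParam_eq`). For positive total weight this gives the infimum and its
unique minimizer.

Upper bound: a Chernoff bound that tilts both arms to that weighted mean gives exactly
`pairExponent` at the sample counts, for every sample size (`measureReal_sampleMeans_le_le_exp`);
homogeneity and continuity in the weights turn it into the rate.

Lower bound: tilt one arm just below the minimizer and the other just above. Chebyshev under the
tilted laws makes the inversion likely, and undoing the tilts costs the two divergences
(`exists_mul_exp_le_sampleMeans_lt`). An arm of rate zero may keep a bounded number of samples, so
these bounds must hold for all positive sample sizes, with a uniform constant.

For sets of arms, an error contains every strict inversion of a pair and lies in the union of the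
weak ones, so the slowest pair decides (`hasDecayRate_of_le_of_le`). -/

lemma mgf_sum_range_eq_pow (hind : iIndepFun X μ) (hX : ∀ s, AEMeasurable (X s) μ)
    (hid : ∀ s, mgf (X s) μ = mgf (X 0) μ) (m : ℕ) (t : ℝ) :
    mgf (fun ω => ∑ s ∈ Finset.range m, X s ω) μ t = mgf (X 0) μ t ^ m := by
  have h := hind.mgf_sum₀ (t := t) hX (Finset.range m)
  have e : (∑ s ∈ Finset.range m, X s) = fun ω => ∑ s ∈ Finset.range m, X s ω := by
    ext ω; simp
  rw [← e, h]
  simp [hid]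

lemma cgf_sum_range_eq_mul (hind : iIndepFun X μ) (hX : ∀ s, AEMeasurable (X s) μ)
    (hid : ∀ s, mgf (X s) μ = mgf (X 0) μ) (m : ℕ) :
    cgf (fun ω => ∑ s ∈ Finset.range m, X s ω) μ = fun t => (m : ℝ) * cgf (X 0) μ t := by
  ext t
  rw [cgf, mgf_sum_range_eq_pow hind hX hid, Real.log_pow, cgf]

variable [IsProbabilityMeasure μ]

/-- Without integrability the `mgf` would take its default value 0, whereas the product formula,
which needs no integrability, gives a power of a positive number. -/
lemma integrable_exp_mul_sum_range (hind : iIndepFun X μ) (hX : ∀ s, AEMeasurable (X s) μ)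
    (hid : ∀ s, mgf (X s) μ = mgf (X 0) μ) (m : ℕ) {t : ℝ} (ht : t ∈ integrableExpSet (X 0) μ) :
    t ∈ integrableExpSet (fun ω => ∑ s ∈ Finset.range m, X s ω) μ := by
  by_contra h
  have h0 : mgf (fun ω => ∑ s ∈ Finset.range m, X s ω) μ t = 0 := integral_undef h
  rw [mgf_sum_range_eq_pow hind hX hid] at h0
  exact (pow_pos (mgf_pos ht) m).ne' h0

lemma mem_interior_integrableExpSet_sum_range (hind : iIndepFun X μ)
    (hX : ∀ s, AEMeasurable (X s) μ) (hid : ∀ s, mgf (X s) μ = mgf (X 0) μ) (m : ℕ) {t : ℝ}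
    (ht : t ∈ interior (integrableExpSet (X 0) μ)) :
    t ∈ interior (integrableExpSet (fun ω => ∑ s ∈ Finset.range m, X s ω) μ) :=
  interior_mono (fun _ hu => integrable_exp_mul_sum_range hind hX hid m hu) ht

lemma integral_tilted_sum_range (hind : iIndepFun X μ) (hX : ∀ s, AEMeasurable (X s) μ)
    (hid : ∀ s, mgf (X s) μ = mgf (X 0) μ) (m : ℕ) {t : ℝ}
    (ht : t ∈ interior (integrableExpSet (X 0) μ)) :
    ∫ ω, (∑ s ∈ Finset.range m, X s ω) ∂(μ.tilted fun ω => t * ∑ s ∈ Finset.range m, X s ω)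
      = m * deriv (cgf (X 0) μ) t := by
  rw [integral_tilted_mul_self (X := fun ω => ∑ s ∈ Finset.range m, X s ω)
    (mem_interior_integrableExpSet_sum_range hind hX hid m ht), cgf_sum_range_eq_mul hind hX hid,
    deriv_const_mul_field]

lemma variance_tilted_sum_range (hind : iIndepFun X μ) (hX : ∀ s, AEMeasurable (X s) μ)
    (hid : ∀ s, mgf (X s) μ = mgf (X 0) μ) (m : ℕ) {t : ℝ}
    (ht : t ∈ interior (integrableExpSet (X 0) μ)) :
    variance (fun ω => ∑ s ∈ Finset.range m, X s ω)
      (μ.tilted fun ω => t * ∑ s ∈ Finset.range m, X s ω)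
      = m * iteratedDeriv 2 (cgf (X 0) μ) t := by
  rw [variance_tilted_mul (X := fun ω => ∑ s ∈ Finset.range m, X s ω)
    (mem_interior_integrableExpSet_sum_range hind hX hid m ht), cgf_sum_range_eq_mul hind hX hid,
    iteratedDeriv_const_mul_field]

/-- Change of measure: an event on which `t * W ≤ c` has under the tilted measure at most
`exp (c - cgf W μ t)` times its probability. -/
lemma tilted_real_le_exp_mul {W : Ω → ℝ} {t c : ℝ}
    (ht : t ∈ integrableExpSet W μ) {s : Set ℝ}
    (hc : ∀ w ∈ s, t * w ≤ c) :
    (μ.tilted fun ω => t * W ω).real (W ⁻¹' s) ≤ Real.exp (c - cgf W μ t) * μ.real (W ⁻¹' s) := by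
  rw [measureReal_def, tilted_mul_apply_cgf (W ⁻¹' s) ht]
  have hle : ∫⁻ a in W ⁻¹' s, ENNReal.ofReal (Real.exp (t * W a - cgf W μ t)) ∂μ
      ≤ ENNReal.ofReal (Real.exp (c - cgf W μ t)) * μ (W ⁻¹' s) := by
    rw [← setLIntegral_const]
    refine setLIntegral_mono_ae (by fun_prop) (Eventually.of_forall fun ω hω => ?_)
    exact ENNReal.ofReal_le_ofReal (Real.exp_le_exp.2 (by linarith [hc _ hω]))
  refine (ENNReal.toReal_mono (by finiteness) hle).trans_eq ?_
  rw [ENNReal.toReal_mul, ENNReal.toReal_ofReal (Real.exp_pos _).le, measureReal_def]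

/-- Under the tilt by `t` the sum has mean `m * x` and variance `m * V`, so by Chebyshev the window
has tilted mass at least 1/2 for large `m`; the change of measure does the rest. -/
lemma eventually_half_exp_le_abs_sum_sub_lt (hind : iIndepFun X μ)
    (hX : ∀ s, AEMeasurable (X s) μ) (hid : ∀ s, mgf (X s) μ = mgf (X 0) μ) {t : ℝ}
    (ht : t ∈ interior (integrableExpSet (X 0) μ)) {ε : ℝ} (hε : 0 < ε) :
    ∀ᶠ m : ℕ in atTop,
      1 / 2 * Real.exp (-(m * (t * deriv (cgf (X 0) μ) t - cgf (X 0) μ t + |t| * ε))) ≤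
        μ.real {ω | |(∑ s ∈ Finset.range m, X s ω) - m * deriv (cgf (X 0) μ) t| < m * ε} := by
  set x := deriv (cgf (X 0) μ) t with hx
  set V := iteratedDeriv 2 (cgf (X 0) μ) t with hV
  have hlim : Tendsto (fun m : ℕ => V / ε ^ 2 / (m : ℝ)) atTop (𝓝 0) :=
    tendsto_const_div_atTop_nhds_zero_nat _
  filter_upwards [hlim.eventually (gt_mem_nhds (by norm_num : (0 : ℝ) < 1 / 2)),
    eventually_gt_atTop 0] with m hm hm0
  have hm0' : (0 : ℝ) < m := by exact_mod_cast hm0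
  set W : Ω → ℝ := fun ω => ∑ s ∈ Finset.range m, X s ω with hWdef
  have htW : t ∈ interior (integrableExpSet W μ) :=
    mem_interior_integrableExpSet_sum_range hind hX hid m ht
  have hWm : AEMeasurable W μ := aemeasurable_of_mem_interior_integrableExpSet htW
  set Q := μ.tilted fun ω => t * W ω with hQ
  have : IsProbabilityMeasure Q := isProbabilityMeasure_tilted (interior_subset htW :)
  have hmean : ∫ ω, W ω ∂Q = m * x := integral_tilted_sum_range hind hX hid m ht
  have hvar : variance W Q = m * V := variance_tilted_sum_range hind hX hid m ht
  have hmem : MemLp W 2 Q := memLp_tilted_mul htW 2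
  have hcheb := meas_ge_le_variance_div_sq hmem (c := m * ε) (by positivity)
  rw [hmean, hvar] at hcheb
  have hbad : Q.real {ω | m * ε ≤ |W ω - m * x|} ≤ 1 / 2 := by
    rw [measureReal_def]
    refine (ENNReal.toReal_le_of_le_ofReal ?_ hcheb).trans ?_
    · rw [← hvar]; exact div_nonneg (variance_nonneg _ _) (by positivity)
    · refine le_trans (le_of_eq ?_) hm.le
      field_simp
  let E : Set ℝ := {w | |w - m * x| < m * ε}
  have hE : MeasurableSet E := (isOpen_lt (by fun_prop) (by fun_prop)).measurableSet
  have hWQ : AEMeasurable W Q := hWm.mono_ac (tilted_absolutelyContinuous _ _)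
  have hgood : 1 / 2 ≤ Q.real (W ⁻¹' E) := by
    have hc : (W ⁻¹' E)ᶜ = {ω | m * ε ≤ |W ω - m * x|} := by ext ω; simp [E]
    have h1 : Q.real (W ⁻¹' E)ᶜ = 1 - Q.real (W ⁻¹' E) := by
      rw [measureReal_def, measureReal_def, prob_compl_eq_one_sub₀ (hWQ.nullMeasurable hE),
        ENNReal.toReal_sub_of_le prob_le_one ENNReal.one_ne_top, ENNReal.toReal_one]
    rw [hc] at h1
    linarith
  -- This `c` bounds `t * w` on the window whatever the sign of `t`.
  have hcom := tilted_real_le_exp_mul (interior_subset htW) (s := E)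
    (c := m * (t * x + |t| * ε)) (fun w hw => ?_)
  · have hcgf : cgf W μ t = m * cgf (X 0) μ t := congrFun (cgf_sum_range_eq_mul hind hX hid m) t
    rw [hcgf] at hcom
    have h2 := hgood.trans hcom
    have h3 : Real.exp (-(m * (t * x - cgf (X 0) μ t + |t| * ε))) *
        Real.exp (m * (t * x + |t| * ε) - m * cgf (X 0) μ t) = 1 := by
      rw [← Real.exp_add, Real.exp_eq_one_iff]; ring
    calc 1 / 2 * Real.exp (-(m * (t * x - cgf (X 0) μ t + |t| * ε)))
        ≤ Real.exp (m * (t * x + |t| * ε) - m * cgf (X 0) μ t) * μ.real (W ⁻¹' E) *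
          Real.exp (-(m * (t * x - cgf (X 0) μ t + |t| * ε))) := by gcongr
      _ = μ.real (W ⁻¹' E) := by
          rw [mul_comm, ← mul_assoc, h3, one_mul]
  · have h4 : t * (w - m * x) ≤ |t| * (m * ε) := by
      refine (le_abs_self _).trans ?_
      rw [abs_mul]
      exact mul_le_mul_of_nonneg_left (le_of_lt hw) (abs_nonneg _)
    linarith

/-- Only finitely many sizes escape the asymptotic bound, and positivity there is absorbed in the
constant. This serves arms whose sample count need not tend to infinity. -/
lemma exists_pos_mul_exp_le {p : ℕ → ℝ} {r : ℝ} (hp : ∀ m, 0 < m → 0 < p m)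
    (hr : ∀ᶠ m : ℕ in atTop, 1 / 2 * Real.exp (-(m * r)) ≤ p m) :
    ∃ c > 0, ∀ m : ℕ, 0 < m → c * Real.exp (-(m * r)) ≤ p m := by
  obtain ⟨M, hM⟩ := eventually_atTop.1 hr
  obtain ⟨c, hc, hcM⟩ : ∃ c > 0, ∀ m ∈ Finset.range M, 0 < m → c * Real.exp (-(m * r)) ≤ p m := by
    clear hM
    induction M with
    | zero => exact ⟨1, one_pos, by simp⟩
    | succ M ih =>
      obtain ⟨c, hc, h⟩ := ih
      rcases Nat.eq_zero_or_pos M with rfl | hM0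
      · exact ⟨1, one_pos, fun m hm hm0 => by simp at hm; omega⟩
      have hpos : 0 < p M / Real.exp (-(M * r)) := div_pos (hp M hM0) (Real.exp_pos _)
      refine ⟨min c (p M / Real.exp (-(M * r))), lt_min hc hpos, fun m hm hm0 => ?_⟩
      rcases Nat.lt_succ_iff_lt_or_eq.1 (Finset.mem_range.1 hm) with h1 | rfl
      · exact le_trans (by gcongr; exact min_le_left _ _) (h m (Finset.mem_range.2 h1) hm0)
      · exact (le_div_iff₀ (Real.exp_pos _)).1 (min_le_right _ _)
  refine ⟨min c (1 / 2), lt_min hc (by norm_num), fun m hm => ?_⟩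
  rcases lt_or_ge m M with h | h
  · exact le_trans (by gcongr; exact min_le_left _ _) (hcM m (Finset.mem_range.2 h) hm)
  · exact le_trans (by gcongr; exact min_le_right _ _) (hM m h)

/-- A variable whose tilted mean is below `m * z` cannot be almost surely at least `m * z`, and the
tilted measure is absolutely continuous with respect to `μ`. -/
lemma measureReal_sum_lt_pos (hind : iIndepFun X μ)
    (hX : ∀ s, AEMeasurable (X s) μ) (hid : ∀ s, mgf (X s) μ = mgf (X 0) μ) {t z : ℝ}
    (ht : t ∈ interior (integrableExpSet (X 0) μ)) (hz : deriv (cgf (X 0) μ) t < z)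
    {m : ℕ} (hm : 0 < m) :
    0 < μ.real {ω | ∑ s ∈ Finset.range m, X s ω < m * z} := by
  have hm0' : (0 : ℝ) < m := by exact_mod_cast hm
  set W : Ω → ℝ := fun ω => ∑ s ∈ Finset.range m, X s ω with hWdef
  have htW : t ∈ interior (integrableExpSet W μ) :=
    mem_interior_integrableExpSet_sum_range hind hX hid m ht
  set Q := μ.tilted fun ω => t * W ω with hQ
  have : IsProbabilityMeasure Q := isProbabilityMeasure_tilted (interior_subset htW :)
  have hmean : ∫ ω, W ω ∂Q = m * deriv (cgf (X 0) μ) t := integral_tilted_sum_range hind hX hid m ht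
  have hint : Integrable W Q := memLp_one_iff_integrable.1 (memLp_tilted_mul htW 1)
  refine measureReal_nonneg.lt_of_ne' fun h => ?_
  have h0 := (measureReal_eq_zero_iff).1 h
  have hQ0 : Q {ω | W ω < m * z} = 0 := tilted_absolutelyContinuous _ _ h0
  have hae : ∀ᵐ ω ∂Q, (m * z : ℝ) ≤ W ω := by
    rw [ae_iff]; simpa using hQ0
  have hle := integral_mono_ae (integrable_const (m * z : ℝ)) hint hae
  rw [hmean] at hle
  simp only [integral_const, probReal_univ, one_smul] at hle
  exact absurd (le_of_mul_le_mul_left hle hm0') (not_le.2 hz)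

lemma measureReal_lt_sum_pos (hind : iIndepFun X μ)
    (hX : ∀ s, AEMeasurable (X s) μ) (hid : ∀ s, mgf (X s) μ = mgf (X 0) μ) {t z : ℝ}
    (ht : t ∈ interior (integrableExpSet (X 0) μ)) (hz : z < deriv (cgf (X 0) μ) t)
    {m : ℕ} (hm : 0 < m) :
    0 < μ.real {ω | m * z < ∑ s ∈ Finset.range m, X s ω} := by
  have hm0' : (0 : ℝ) < m := by exact_mod_cast hm
  set W : Ω → ℝ := fun ω => ∑ s ∈ Finset.range m, X s ω with hWdef
  have htW : t ∈ interior (integrableExpSet W μ) :=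
    mem_interior_integrableExpSet_sum_range hind hX hid m ht
  set Q := μ.tilted fun ω => t * W ω with hQ
  have : IsProbabilityMeasure Q := isProbabilityMeasure_tilted (interior_subset htW :)
  have hmean : ∫ ω, W ω ∂Q = m * deriv (cgf (X 0) μ) t := integral_tilted_sum_range hind hX hid m ht
  have hint : Integrable W Q := memLp_one_iff_integrable.1 (memLp_tilted_mul htW 1)
  refine measureReal_nonneg.lt_of_ne' fun h => ?_
  have h0 := (measureReal_eq_zero_iff).1 h
  have hQ0 : Q {ω | m * z < W ω} = 0 := tilted_absolutelyContinuous _ _ h0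
  have hae : ∀ᵐ ω ∂Q, W ω ≤ (m * z : ℝ) := by
    rw [ae_iff]; simpa using hQ0
  have hle := integral_mono_ae hint (integrable_const (m * z : ℝ)) hae
  rw [hmean] at hle
  simp only [integral_const, probReal_univ, one_smul] at hle
  exact absurd (le_of_mul_le_mul_left hle hm0') (not_le.2 hz)

lemma eventually_half_exp_le_of_abs_sub_lt_subset (hind : iIndepFun X μ)
    (hX : ∀ s, AEMeasurable (X s) μ) (hid : ∀ s, mgf (X s) μ = mgf (X 0) μ) {t : ℝ}
    (ht : t ∈ interior (integrableExpSet (X 0) μ)) {ε₀ δ : ℝ} (hε₀ : 0 < ε₀) (hδ : 0 < δ)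
    {U : ℕ → Set ℝ} (hU : ∀ (m : ℕ) (w : ℝ), |w - m * deriv (cgf (X 0) μ) t| < m * ε₀ → w ∈ U m) :
    ∀ᶠ m : ℕ in atTop,
      1 / 2 * Real.exp (-(m * (t * deriv (cgf (X 0) μ) t - cgf (X 0) μ t + δ))) ≤
        μ.real {ω | ∑ s ∈ Finset.range m, X s ω ∈ U m} := by
  obtain ⟨ε, hε, hε1, hε2⟩ : ∃ ε > 0, ε ≤ ε₀ ∧ |t| * ε ≤ δ := by
    -- The `+ 1` covers `t = 0`.
    refine ⟨min ε₀ (δ / (|t| + 1)), by positivity, min_le_left _ _, ?_⟩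
    calc |t| * min ε₀ (δ / (|t| + 1)) ≤ (|t| + 1) * (δ / (|t| + 1)) := by
          gcongr
          · linarith
          · exact min_le_right _ _
      _ = δ := by field_simp
  filter_upwards [eventually_half_exp_le_abs_sum_sub_lt hind hX hid ht hε] with m hm
  refine le_trans (le_trans ?_ hm) (measureReal_mono fun ω hω => hU m _ ?_)
  · gcongr
  · exact lt_of_lt_of_le hω (by gcongr)

theorem exists_mul_exp_le_measureReal_sum_lt (hind : iIndepFun X μ)
    (hX : ∀ s, AEMeasurable (X s) μ) (hid : ∀ s, mgf (X s) μ = mgf (X 0) μ) {t z δ : ℝ}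
    (ht : t ∈ interior (integrableExpSet (X 0) μ)) (hz : deriv (cgf (X 0) μ) t < z)
    (hδ : 0 < δ) :
    ∃ c > 0, ∀ m : ℕ, 0 < m →
      c * Real.exp (-(m * (t * deriv (cgf (X 0) μ) t - cgf (X 0) μ t + δ))) ≤
        μ.real {ω | ∑ s ∈ Finset.range m, X s ω < m * z} := by
  refine exists_pos_mul_exp_le (fun m hm => measureReal_sum_lt_pos hind hX hid ht hz hm) ?_
  refine eventually_half_exp_le_of_abs_sub_lt_subset hind hX hid ht (sub_pos.2 hz) hδ
    (U := fun m => {w | w < m * z}) fun m w hw => ?_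
  have := (abs_lt.1 hw).2
  show w < m * z
  linarith

theorem exists_mul_exp_le_measureReal_lt_sum (hind : iIndepFun X μ)
    (hX : ∀ s, AEMeasurable (X s) μ) (hid : ∀ s, mgf (X s) μ = mgf (X 0) μ) {t z δ : ℝ}
    (ht : t ∈ interior (integrableExpSet (X 0) μ)) (hz : z < deriv (cgf (X 0) μ) t)
    (hδ : 0 < δ) :
    ∃ c > 0, ∀ m : ℕ, 0 < m →
      c * Real.exp (-(m * (t * deriv (cgf (X 0) μ) t - cgf (X 0) μ t + δ))) ≤
        μ.real {ω | m * z < ∑ s ∈ Finset.range m, X s ω} := by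
  refine exists_pos_mul_exp_le (fun m hm => measureReal_lt_sum_pos hind hX hid ht hz hm) ?_
  refine eventually_half_exp_le_of_abs_sub_lt_subset hind hX hid ht (sub_pos.2 hz) hδ
    (U := fun m => {w | m * z < w}) fun m w hw => ?_
  have := (abs_lt.1 hw).1
  show m * z < w
  linarith

end Iid

/-! ### Exponential families -/

section Family

variable {ν : Measure ℝ}

/-- The log-partition function `A η = log ∫ exp (η y) dν(y)`. -/
noncomputable def logPartition (ν : Measure ℝ) (η : ℝ) : ℝ :=
  cgf (fun y : ℝ => y) ν η

/-- The divergence from the member with parameter `η` to the member with parameter `η'`, in terms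
of the log-partition function. -/
noncomputable def klParam (ν : Measure ℝ) (η η' : ℝ) : ℝ :=
  (η - η') * meanOf ν η - logPartition ν η + logPartition ν η'

/-- The weighted mean of two natural parameters. -/
noncomputable def mixParam (w₁ w₂ η₁ η₂ : ℝ) : ℝ :=
  (w₁ * η₁ + w₂ * η₂) / (w₁ + w₂)

/-- The exponent of the pairwise comparison, in terms of the log-partition function. -/
noncomputable def pairExponent (ν : Measure ℝ) (w₁ w₂ η₁ η₂ : ℝ) : ℝ :=
  w₁ * logPartition ν η₁ + w₂ * logPartition ν η₂
    - (w₁ + w₂) * logPartition ν (mixParam w₁ w₂ η₁ η₂)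

lemma meanOf_eq_deriv {η : ℝ} (hη : η ∈ interior (naturalSpace ν)) :
    meanOf ν η = deriv (logPartition ν) η :=
  integral_tilted_mul_self (X := fun y : ℝ => y) hη

lemma analyticAt_logPartition {η : ℝ} (hη : η ∈ interior (naturalSpace ν)) :
    AnalyticAt ℝ (logPartition ν) η :=
  analyticAt_cgf (X := fun y : ℝ => y) hη

lemma continuousAt_logPartition {η : ℝ} (hη : η ∈ interior (naturalSpace ν)) :
    ContinuousAt (logPartition ν) η :=
  (analyticAt_logPartition hη).continuousAt

lemma continuousAt_meanOf {η : ℝ} (hη : η ∈ interior (naturalSpace ν)) :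
    ContinuousAt (meanOf ν) η := by
  refine (analyticAt_logPartition hη).deriv.continuousAt.congr ?_
  filter_upwards [isOpen_interior.mem_nhds hη] with u hu using (meanOf_eq_deriv hu).symm

lemma continuousAt_klParam_left (η' : ℝ) {η : ℝ} (hη : η ∈ interior (naturalSpace ν)) :
    ContinuousAt (fun u => klParam ν u η') η := by
  unfold klParam
  exact (((continuousAt_id.sub continuousAt_const).mul (continuousAt_meanOf hη)).sub
    (continuousAt_logPartition hη)).add continuousAt_const

lemma convex_interior_naturalSpace : Convex ℝ (interior (naturalSpace ν)) :=
  (convex_integrableExpSet (X := fun y : ℝ => y)).interior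

lemma NonSingular.ne_zero (hν : NonSingular ν) {η : ℝ} (hη : η ∈ interior (naturalSpace ν)) :
    ν ≠ 0 := by
  rintro rfl
  have := hν η hη
  simp [expMember] at this

/-- The mean is the derivative of the log-partition function, and the variance is its second
derivative. -/
lemma NonSingular.strictMonoOn_meanOf (hν : NonSingular ν) :
    StrictMonoOn (meanOf ν) (interior (naturalSpace ν)) := by
  have h : StrictMonoOn (deriv (logPartition ν)) (interior (naturalSpace ν)) := by
    refine strictMonoOn_of_deriv_pos convex_interior_naturalSpace
      (fun u hu => (analyticAt_logPartition hu).deriv.continuousAt.continuousWithinAt)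
      fun u hu => ?_
    rw [interior_interior] at hu
    have h1 := hν u hu
    have h2 : variance (fun y : ℝ => y) (expMember ν u) = iteratedDeriv 2 (logPartition ν) u :=
      variance_tilted_mul (X := fun y : ℝ => y) hu
    rwa [h2, iteratedDeriv_succ, iteratedDeriv_one] at h1
  exact h.congr fun u hu => (meanOf_eq_deriv hu).symm

lemma paramOf_mem {x : ℝ} (hx : x ∈ meanSpace ν) : paramOf ν x ∈ interior (naturalSpace ν) :=
  Function.invFunOn_mem hx

lemma meanOf_paramOf {x : ℝ} (hx : x ∈ meanSpace ν) : meanOf ν (paramOf ν x) = x :=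
  Function.invFunOn_eq hx

lemma NonSingular.paramOf_meanOf (hν : NonSingular ν) {η : ℝ}
    (hη : η ∈ interior (naturalSpace ν)) : paramOf ν (meanOf ν η) = η :=
  hν.strictMonoOn_meanOf.injOn.leftInvOn_invFunOn hη

lemma NonSingular.paramOf_lt_paramOf (hν : NonSingular ν) {x y : ℝ} (hx : x ∈ meanSpace ν)
    (hy : y ∈ meanSpace ν) (hxy : x < y) : paramOf ν x < paramOf ν y := by
  rw [← hν.strictMonoOn_meanOf.lt_iff_lt (paramOf_mem hx) (paramOf_mem hy), meanOf_paramOf hx,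
    meanOf_paramOf hy]
  exact hxy

lemma isProbabilityMeasure_expMember (h0 : ν ≠ 0) {η : ℝ} (hη : η ∈ naturalSpace ν) :
    IsProbabilityMeasure (expMember ν η) :=
  have : NeZero ν := ⟨h0⟩
  isProbabilityMeasure_tilted hη

lemma integrable_exp_mul_expMember_iff {η u : ℝ} (hη : η ∈ naturalSpace ν) :
    Integrable (fun y => Real.exp (u * y)) (expMember ν η) ↔ η + u ∈ naturalSpace ν := by
  rw [expMember, integrable_tilted_iff hη]
  simp only [smul_eq_mul, ← Real.exp_add, ← add_mul]
  rfl

lemma tilted_expMember {η u : ℝ} (hη : η ∈ naturalSpace ν) :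
    (expMember ν η).tilted (fun y => u * y) = expMember ν (η + u) := by
  rw [expMember, tilted_tilted hη, expMember]
  congr 1
  ext y
  simp [add_mul]

lemma cgf_expMember (h0 : ν ≠ 0) {η u : ℝ} (hη : η ∈ naturalSpace ν)
    (hu : η + u ∈ naturalSpace ν) :
    cgf (fun y : ℝ => y) (expMember ν η) u = logPartition ν (η + u) - logPartition ν η := by
  have : NeZero ν := ⟨h0⟩
  have h := integral_exp_tilted (μ := ν) (fun y : ℝ => η * y) (fun y => u * y)
  have e : (fun y : ℝ => Real.exp (((fun y => η * y) + fun y => u * y) y))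
      = fun y => Real.exp ((η + u) * y) := by
    ext y; simp [add_mul]
  rw [e] at h
  rw [cgf, mgf, expMember, h, Real.log_div (integral_exp_pos hu).ne' (integral_exp_pos hη).ne']
  rfl

lemma integrable_id_expMember {η : ℝ} (hη : η ∈ interior (naturalSpace ν)) :
    Integrable (fun y : ℝ => y) (expMember ν η) :=
  memLp_one_iff_integrable.1 (memLp_tilted_mul (X := fun y : ℝ => y) hη 1)

/-! ### Divergences between members of the family -/

section KL

open InformationTheory

variable {η η' : ℝ}

lemma llr_expMember (h0 : ν ≠ 0) (hη : η ∈ naturalSpace ν) (hη' : η' ∈ naturalSpace ν) :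
    llr (expMember ν η) (expMember ν η') =ᵐ[expMember ν η]
      fun y => (η - η') * y - (logPartition ν η - logPartition ν η') := by
  have := isProbabilityMeasure_expMember h0 hη'
  have hu : Integrable (fun y => Real.exp ((η - η') * y)) (expMember ν η') :=
    (integrable_exp_mul_expMember_iff hη').2 (by simpa using hη)
  have ht : (expMember ν η').tilted (fun y => (η - η') * y) = expMember ν η := by
    rw [tilted_expMember hη', add_sub_cancel]
  have h := log_rnDeriv_tilted_left_self hu
  have hc := cgf_expMember h0 (u := η - η') hη' (by simpa using hη)
  rw [add_sub_cancel] at hc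
  rw [ht] at h
  have hac : expMember ν η ≪ expMember ν η' := ht ▸ tilted_absolutelyContinuous _ _
  filter_upwards [hac.ae_le h] with y hy
  rw [llr, hy, ← hc]
  rfl

lemma expMember_absolutelyContinuous (η : ℝ) (hη' : η' ∈ naturalSpace ν) :
    expMember ν η ≪ expMember ν η' :=
  (tilted_absolutelyContinuous _ _).trans (absolutelyContinuous_tilted hη')

lemma klDiv_expMember_ne_top (h0 : ν ≠ 0) (hη : η ∈ interior (naturalSpace ν))
    (hη' : η' ∈ naturalSpace ν) : klDiv (expMember ν η) (expMember ν η') ≠ ⊤ := by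
  have := isProbabilityMeasure_expMember h0 (interior_subset hη)
  refine klDiv_ne_top (expMember_absolutelyContinuous η hη') ?_
  rw [integrable_congr (llr_expMember h0 (interior_subset hη) hη')]
  exact ((integrable_id_expMember hη).const_mul _).sub (integrable_const _)

lemma toReal_klDiv_expMember (h0 : ν ≠ 0) (hη : η ∈ interior (naturalSpace ν))
    (hη' : η' ∈ naturalSpace ν) :
    (klDiv (expMember ν η) (expMember ν η')).toReal = klParam ν η η' := by
  have := isProbabilityMeasure_expMember h0 (interior_subset hη)
  have := isProbabilityMeasure_expMember h0 hη'
  rw [toReal_klDiv_of_measure_eq (expMember_absolutelyContinuous η hη')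
    (by simp), integral_congr_ae (llr_expMember h0 (interior_subset hη) hη'),
    integral_sub ((integrable_id_expMember hη).const_mul _) (integrable_const _),
    integral_const_mul, klParam, meanOf]
  simp
  ring

lemma klParam_nonneg (h0 : ν ≠ 0) (hη : η ∈ interior (naturalSpace ν))
    (hη' : η' ∈ naturalSpace ν) : 0 ≤ klParam ν η η' := by
  rw [← toReal_klDiv_expMember h0 hη hη']
  exact ENNReal.toReal_nonneg

lemma NonSingular.eq_of_klParam_eq_zero (hν : NonSingular ν)
    (hη : η ∈ interior (naturalSpace ν)) (hη' : η' ∈ interior (naturalSpace ν))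
    (h : klParam ν η η' = 0) : η = η' := by
  have h0 := hν.ne_zero hη
  have := isProbabilityMeasure_expMember h0 (interior_subset hη)
  have := isProbabilityMeasure_expMember h0 (interior_subset hη')
  -- `toReal` vanishes at `⊤` too, which finiteness of the divergence excludes.
  rw [← toReal_klDiv_expMember h0 hη (interior_subset hη'), ENNReal.toReal_eq_zero_iff,
    or_iff_left (klDiv_expMember_ne_top h0 hη (interior_subset hη')), klDiv_eq_zero_iff] at h
  refine hν.strictMonoOn_meanOf.injOn hη hη' ?_
  rw [meanOf, h, meanOf]

end KL

/-! ### The pairwise infimum and its minimizer -/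

lemma klParam_self (η : ℝ) : klParam ν η η = 0 := by simp [klParam]

lemma mixParam_mem {w₁ w₂ η₁ η₂ : ℝ} (h₁ : 0 ≤ w₁) (h₂ : 0 ≤ w₂) (hw : 0 < w₁ + w₂)
    (hη₁ : η₁ ∈ interior (naturalSpace ν)) (hη₂ : η₂ ∈ interior (naturalSpace ν)) :
    mixParam w₁ w₂ η₁ η₂ ∈ interior (naturalSpace ν) := by
  have h := convex_interior_naturalSpace hη₁ hη₂ (div_nonneg h₁ hw.le) (div_nonneg h₂ hw.le)
    (by field_simp)
  convert h using 1
  simp only [mixParam, smul_eq_mul]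
  field_simp

/-- Apart from `logPartition ν η'`, which does not involve `η`, `klParam ν η η'` is affine in `η'`;
averaging the second argument therefore changes the weighted sum only by a constant in `η`. -/
lemma weighted_klParam_eq {w₁ w₂ : ℝ} (hw : w₁ + w₂ ≠ 0) (η₁ η₂ η : ℝ) :
    w₁ * klParam ν η η₁ + w₂ * klParam ν η η₂ =
      pairExponent ν w₁ w₂ η₁ η₂ + (w₁ + w₂) * klParam ν η (mixParam w₁ w₂ η₁ η₂) := by
  have h : (w₁ + w₂) * mixParam w₁ w₂ η₁ η₂ = w₁ * η₁ + w₂ * η₂ := by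
    rw [mixParam]; field_simp
  simp only [klParam, pairExponent]
  linear_combination (meanOf ν η) * h

variable {w₁ w₂ x₁ x₂ : ℝ}

lemma NonSingular.pairCost_eq (hν : NonSingular ν) (h₁ : x₁ ∈ meanSpace ν)
    (h₂ : x₂ ∈ meanSpace ν) {x : ℝ} (hx : x ∈ meanSpace ν) :
    pairCost ν w₁ w₂ x₁ x₂ x = w₁ * klParam ν (paramOf ν x) (paramOf ν x₁)
      + w₂ * klParam ν (paramOf ν x) (paramOf ν x₂) := by
  have h0 := hν.ne_zero (paramOf_mem hx)
  rw [pairCost, klMean, klMean, memberOfMean, memberOfMean, memberOfMean,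
    toReal_klDiv_expMember h0 (paramOf_mem hx) (interior_subset (paramOf_mem h₁)),
    toReal_klDiv_expMember h0 (paramOf_mem hx) (interior_subset (paramOf_mem h₂))]

lemma NonSingular.pairCost_eq_add (hν : NonSingular ν) (h₁ : x₁ ∈ meanSpace ν)
    (h₂ : x₂ ∈ meanSpace ν) (hw : w₁ + w₂ ≠ 0) {x : ℝ} (hx : x ∈ meanSpace ν) :
    pairCost ν w₁ w₂ x₁ x₂ x = pairExponent ν w₁ w₂ (paramOf ν x₁) (paramOf ν x₂)
      + (w₁ + w₂) * klParam ν (paramOf ν x)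
          (mixParam w₁ w₂ (paramOf ν x₁) (paramOf ν x₂)) := by
  rw [hν.pairCost_eq h₁ h₂ hx, weighted_klParam_eq hw]

lemma NonSingular.pairRate_eq_pairExponent (hν : NonSingular ν)
    (h₁ : x₁ ∈ meanSpace ν) (h₂ : x₂ ∈ meanSpace ν) (hw₁ : 0 ≤ w₁) (hw₂ : 0 ≤ w₂)
    (hw : 0 < w₁ + w₂) :
    pairRate ν w₁ w₂ x₁ x₂ = pairExponent ν w₁ w₂ (paramOf ν x₁) (paramOf ν x₂) := by
  set η := mixParam w₁ w₂ (paramOf ν x₁) (paramOf ν x₂) with hη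
  have hmem : η ∈ interior (naturalSpace ν) :=
    mixParam_mem hw₁ hw₂ hw (paramOf_mem h₁) (paramOf_mem h₂)
  refine IsLeast.csInf_eq ⟨⟨meanOf ν η, ⟨η, hmem, rfl⟩, ?_⟩, ?_⟩
  · rw [hν.pairCost_eq_add h₁ h₂ hw.ne' ⟨η, hmem, rfl⟩, hν.paramOf_meanOf hmem, ← hη,
      klParam_self, mul_zero, add_zero]
  · rintro _ ⟨x, hx, rfl⟩
    rw [hν.pairCost_eq_add h₁ h₂ hw.ne' hx]
    have := klParam_nonneg (hν.ne_zero hmem) (paramOf_mem hx) (interior_subset hmem)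
    have := mul_nonneg hw.le this
    linarith

lemma NonSingular.exists_mem_interior_weighted_klParam_eq_pairRate (hν : NonSingular ν)
    (h₁ : x₁ ∈ meanSpace ν) (h₂ : x₂ ∈ meanSpace ν) (hw₁ : 0 ≤ w₁) (hw₂ : 0 ≤ w₂) :
    ∃ η ∈ interior (naturalSpace ν), w₁ * klParam ν η (paramOf ν x₁)
      + w₂ * klParam ν η (paramOf ν x₂) = pairRate ν w₁ w₂ x₁ x₂ := by
  rcases (add_nonneg hw₁ hw₂).eq_or_lt' with hw | hw
  -- With zero total weight `mixParam` is `0 / 0 = 0`, possibly outside the parameter space; but the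
  -- cost vanishes identically and any parameter serves.
  · obtain rfl : w₁ = 0 := by linarith
    obtain rfl : w₂ = 0 := by linarith
    refine ⟨paramOf ν x₁, paramOf_mem h₁, ?_⟩
    have : pairCost ν 0 0 x₁ x₂ '' meanSpace ν = {0} := by
      refine Set.Subset.antisymm ?_ ?_
      · rintro _ ⟨x, _, rfl⟩; simp [pairCost]
      · rintro _ rfl; exact ⟨x₁, h₁, by simp [pairCost]⟩
    simp [pairRate, this]
  · have hmem := mixParam_mem hw₁ hw₂ hw (paramOf_mem h₁) (paramOf_mem h₂)
    refine ⟨_, hmem, ?_⟩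
    rw [weighted_klParam_eq hw.ne', klParam_self, mul_zero, add_zero,
      hν.pairRate_eq_pairExponent h₁ h₂ hw₁ hw₂ hw]

theorem NonSingular.existsUnique_isMinOn_pairCost (hν : NonSingular ν)
    (h₁ : x₁ ∈ meanSpace ν) (h₂ : x₂ ∈ meanSpace ν) (hw₁ : 0 ≤ w₁) (hw₂ : 0 ≤ w₂)
    (hw : 0 < w₁ + w₂) :
    ∃! x, x ∈ meanSpace ν ∧ IsMinOn (pairCost ν w₁ w₂ x₁ x₂) (meanSpace ν) x := by
  set η := mixParam w₁ w₂ (paramOf ν x₁) (paramOf ν x₂) with hη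
  have hmem : η ∈ interior (naturalSpace ν) :=
    mixParam_mem hw₁ hw₂ hw (paramOf_mem h₁) (paramOf_mem h₂)
  have hval : pairCost ν w₁ w₂ x₁ x₂ (meanOf ν η)
      = pairExponent ν w₁ w₂ (paramOf ν x₁) (paramOf ν x₂) := by
    rw [hν.pairCost_eq_add h₁ h₂ hw.ne' ⟨η, hmem, rfl⟩, hν.paramOf_meanOf hmem, ← hη,
      klParam_self, mul_zero, add_zero]
  have hnn : ∀ x ∈ meanSpace ν, 0 ≤ klParam ν (paramOf ν x) η := fun x hx =>
    klParam_nonneg (hν.ne_zero hmem) (paramOf_mem hx) (interior_subset hmem)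
  refine ⟨meanOf ν η, ⟨⟨η, hmem, rfl⟩, fun x hx => ?_⟩, ?_⟩
  · rw [Set.mem_ofPred_eq, hval, hν.pairCost_eq_add h₁ h₂ hw.ne' hx]
    have := mul_nonneg hw.le (hnn x hx)
    linarith
  · rintro x ⟨hx, hmin⟩
    have hle := hmin (⟨η, hmem, rfl⟩ : meanOf ν η ∈ meanSpace ν)
    rw [Set.mem_ofPred_eq, hval, hν.pairCost_eq_add h₁ h₂ hw.ne' hx, ← hη] at hle
    have h0 : klParam ν (paramOf ν x) η = 0 := by
      refine le_antisymm ?_ (hnn x hx)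
      by_contra hcon
      have := mul_pos hw (not_le.1 hcon)
      linarith
    rw [← hν.eq_of_klParam_eq_zero (paramOf_mem hx) hmem h0, meanOf_paramOf hx]

end Family

/-! ### Sums of rewards -/

section Rewards

variable {ν : Measure ℝ} {Ω : Type*} [MeasurableSpace Ω] {μ : Measure Ω}

/-! ### Tilting the rewards of one arm -/

section OneArm

variable {X : ℕ → Ω → ℝ} {η η' z δ : ℝ}

lemma mgf_eq_mgf_expMember (hX : ∀ s, HasLaw (X s) (expMember ν η) μ) (s : ℕ) :
    mgf (X s) μ = mgf (fun y : ℝ => y) (expMember ν η) := by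
  ext u
  exact (hX s).integral_comp (f := fun y => Real.exp (u * y)) (by fun_prop)

lemma mem_integrableExpSet_iff (hX : ∀ s, HasLaw (X s) (expMember ν η) μ)
    (hη : η ∈ naturalSpace ν) (s : ℕ) (u : ℝ) :
    u ∈ integrableExpSet (X s) μ ↔ η + u ∈ naturalSpace ν := by
  rw [← integrable_exp_mul_expMember_iff hη, ← (hX s).map_eq,
    integrable_map_measure (by fun_prop) (hX s).aemeasurable]
  rfl

lemma sub_mem_interior_integrableExpSet (hX : ∀ s, HasLaw (X s) (expMember ν η) μ)
    (hη : η ∈ naturalSpace ν) (hη' : η' ∈ interior (naturalSpace ν)) :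
    η' - η ∈ interior (integrableExpSet (X 0) μ) := by
  have hopen : IsOpen ((fun u => η + u) ⁻¹' interior (naturalSpace ν)) :=
    isOpen_interior.preimage (by fun_prop)
  refine interior_maximal (fun u hu => ?_) hopen (by simpa using hη')
  exact (mem_integrableExpSet_iff hX hη 0 u).2 (interior_subset hu)

lemma cgf_sub_eq (h0 : ν ≠ 0) (hX : ∀ s, HasLaw (X s) (expMember ν η) μ)
    (hη : η ∈ naturalSpace ν) (hη' : η' ∈ naturalSpace ν) :
    cgf (X 0) μ (η' - η) = logPartition ν η' - logPartition ν η := by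
  have h := cgf_expMember h0 (u := η' - η) hη (by simpa using hη')
  rw [add_sub_cancel] at h
  rw [← h, cgf, cgf, mgf_eq_mgf_expMember hX]

lemma deriv_cgf_sub_eq (h0 : ν ≠ 0) (hX : ∀ s, HasLaw (X s) (expMember ν η) μ)
    (hη : η ∈ naturalSpace ν) (hη' : η' ∈ interior (naturalSpace ν)) :
    deriv (cgf (X 0) μ) (η' - η) = meanOf ν η' := by
  have hev : cgf (X 0) μ =ᶠ[𝓝 (η' - η)]
      fun u => logPartition ν (u + η) - logPartition ν η := by
    have hopen : IsOpen ((fun u => u + η) ⁻¹' interior (naturalSpace ν)) :=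
      isOpen_interior.preimage (by fun_prop)
    filter_upwards [hopen.mem_nhds (by simpa using hη' : η' - η ∈ _)] with u hu
    rw [← cgf_sub_eq h0 hX hη (interior_subset hu), add_sub_cancel_right]
  rw [hev.deriv_eq, deriv_sub_const, deriv_comp_add_const, sub_add_cancel, meanOf_eq_deriv hη']

/-- The Legendre exponent paid for tilting rewards from `η` to `η'` is the divergence of the new
member from the old one. -/
lemma mul_deriv_cgf_sub_cgf (h0 : ν ≠ 0) (hX : ∀ s, HasLaw (X s) (expMember ν η) μ)
    (hη : η ∈ naturalSpace ν) (hη' : η' ∈ interior (naturalSpace ν)) :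
    (η' - η) * deriv (cgf (X 0) μ) (η' - η) - cgf (X 0) μ (η' - η) = klParam ν η' η := by
  rw [deriv_cgf_sub_eq h0 hX hη hη', cgf_sub_eq h0 hX hη (interior_subset hη'), klParam]
  ring

variable [IsProbabilityMeasure μ]

lemma NonSingular.exists_mul_exp_le_sum_lt (hν : NonSingular ν)
    (hX : ∀ s, HasLaw (X s) (expMember ν η) μ) (hind : iIndepFun X μ)
    (hη : η ∈ naturalSpace ν) (hη' : η' ∈ interior (naturalSpace ν)) (hz : meanOf ν η' < z)
    (hδ : 0 < δ) :
    ∃ c > 0, ∀ m : ℕ, 0 < m → c * Real.exp (-(m * (klParam ν η' η + δ))) ≤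
      μ.real {ω | ∑ s ∈ Finset.range m, X s ω < m * z} := by
  have h0 := hν.ne_zero hη'
  have h := exists_mul_exp_le_measureReal_sum_lt (z := z) hind (fun s => (hX s).aemeasurable)
    (fun s => by rw [mgf_eq_mgf_expMember hX, mgf_eq_mgf_expMember hX])
    (sub_mem_interior_integrableExpSet hX hη hη')
    (by rwa [deriv_cgf_sub_eq h0 hX hη hη']) hδ
  rwa [mul_deriv_cgf_sub_cgf h0 hX hη hη'] at h

lemma NonSingular.exists_mul_exp_le_lt_sum (hν : NonSingular ν)
    (hX : ∀ s, HasLaw (X s) (expMember ν η) μ) (hind : iIndepFun X μ)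
    (hη : η ∈ naturalSpace ν) (hη' : η' ∈ interior (naturalSpace ν)) (hz : z < meanOf ν η')
    (hδ : 0 < δ) :
    ∃ c > 0, ∀ m : ℕ, 0 < m → c * Real.exp (-(m * (klParam ν η' η + δ))) ≤
      μ.real {ω | m * z < ∑ s ∈ Finset.range m, X s ω} := by
  have h0 := hν.ne_zero hη'
  have h := exists_mul_exp_le_measureReal_lt_sum (z := z) hind (fun s => (hX s).aemeasurable)
    (fun s => by rw [mgf_eq_mgf_expMember hX, mgf_eq_mgf_expMember hX])
    (sub_mem_interior_integrableExpSet hX hη hη')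
    (by rwa [deriv_cgf_sub_eq h0 hX hη hη']) hδ
  rwa [mul_deriv_cgf_sub_cgf h0 hX hη hη'] at h

lemma mgf_sum_range_expMember (h0 : ν ≠ 0)
    (hX : ∀ s, HasLaw (X s) (expMember ν η) μ) (hind : iIndepFun X μ)
    (hη : η ∈ naturalSpace ν) (hη' : η' ∈ naturalSpace ν) (m : ℕ) :
    Integrable (fun ω => Real.exp ((η' - η) * ∑ s ∈ Finset.range m, X s ω)) μ ∧
    mgf (fun ω => ∑ s ∈ Finset.range m, X s ω) μ (η' - η)
      = Real.exp (m * (logPartition ν η' - logPartition ν η)) := by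
  have hid : ∀ s, mgf (X s) μ = mgf (X 0) μ := fun s => by
    rw [mgf_eq_mgf_expMember hX, mgf_eq_mgf_expMember hX]
  have hint : η' - η ∈ integrableExpSet (fun ω => ∑ s ∈ Finset.range m, X s ω) μ :=
    integrable_exp_mul_sum_range hind (fun s => (hX s).aemeasurable) hid m
      ((mem_integrableExpSet_iff hX hη 0 _).2 (by simpa using hη'))
  refine ⟨hint, ?_⟩
  rw [← exp_cgf hint, cgf_sum_range_eq_mul hind (fun s => (hX s).aemeasurable) hid]
  simp only [cgf_sub_eq h0 hX hη hη']

end OneArm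

/-! ### Comparing the sample means of two arms -/

section TwoArms

variable {K : ℕ} {Y : Fin K → ℕ → Ω → ℝ}

lemma iIndepFun_arm (hind : iIndepFun (fun p : Fin K × ℕ => Y p.1 p.2) μ) (i : Fin K) :
    iIndepFun (Y i) μ :=
  hind.precomp (g := fun s : ℕ => (i, s)) fun _ _ h => (Prod.mk.inj h).2

/-- The two sums are functions of disjoint finite blocks of one independent family. -/
lemma indepFun_sum_range (hY : ∀ i s, AEMeasurable (Y i s) μ)
    (hind : iIndepFun (fun p : Fin K × ℕ => Y p.1 p.2) μ) {i j : Fin K} (hij : i ≠ j)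
    (m m' : ℕ) :
    IndepFun (fun ω => ∑ s ∈ Finset.range m, Y i s ω)
      (fun ω => ∑ s ∈ Finset.range m', Y j s ω) μ := by
  have hd : Disjoint ({i} ×ˢ Finset.range m) ({j} ×ˢ Finset.range m') := by
    rw [Finset.disjoint_left]
    rintro ⟨a, b⟩ h h'
    simp only [Finset.mem_product, Finset.mem_singleton] at h h'
    exact hij (h.1.symm.trans h'.1)
  have h := (hind.indepFun_finset₀ _ _ hd fun p => hY p.1 p.2).comp
    (φ := fun f => ∑ p, f p) (ψ := fun f => ∑ p, f p) (by fun_prop) (by fun_prop)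
  have e (k : Fin K) (n : ℕ) :
      (fun ω => ∑ p : ↥(({k} : Finset (Fin K)) ×ˢ Finset.range n), Y p.1.1 p.1.2 ω)
        = fun ω => ∑ s ∈ Finset.range n, Y k s ω := by
    ext ω
    rw [Finset.sum_coe_sort _ fun p : Fin K × ℕ => Y p.1 p.2 ω]
    simp
  rw [← e i m, ← e j m']
  exact h

variable [IsProbabilityMeasure μ] {η : Fin K → ℝ}

/-- The tilts `ζ - η i` and `ζ - η j`, weighted by the sample counts, cancel. Hence the tilting
exponent is a multiple of the difference of the sample means, nonnegative on the event because `η j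
< η i`. -/
theorem NonSingular.measureReal_sampleMeans_le_le_exp (hν : NonSingular ν)
    (hη : ∀ i, η i ∈ interior (naturalSpace ν))
    (hY : ∀ i s, HasLaw (Y i s) (expMember ν (η i)) μ)
    (hind : iIndepFun (fun p : Fin K × ℕ => Y p.1 p.2) μ) {i j : Fin K} (hij : η j < η i)
    {m : Fin K → ℕ} (hi : 0 < m i) (hj : 0 < m j) :
    μ.real {ω | sampleMeans Y m ω i ≤ sampleMeans Y m ω j} ≤
      Real.exp (-pairExponent ν (m i) (m j) (η i) (η j)) := by
  have h0 := hν.ne_zero (hη i)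
  have hi' : (0 : ℝ) < m i := by exact_mod_cast hi
  have hj' : (0 : ℝ) < m j := by exact_mod_cast hj
  set ζ := mixParam (m i) (m j) (η i) (η j) with hζ
  have hζm : ζ ∈ interior (naturalSpace ν) :=
    mixParam_mem hi'.le hj'.le (by positivity) (hη i) (hη j)
  have hζe : (m i + m j : ℝ) * ζ = m i * η i + m j * η j := by
    rw [hζ, mixParam]; field_simp
  set S := fun ω => ∑ s ∈ Finset.range (m i), Y i s ω with hS
  set T := fun ω => ∑ s ∈ Finset.range (m j), Y j s ω with hT
  obtain ⟨hSi, hSm⟩ := mgf_sum_range_expMember h0 (hY i) (iIndepFun_arm hind i)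
    (interior_subset (hη i)) (interior_subset hζm) (m i)
  obtain ⟨hTi, hTm⟩ := mgf_sum_range_expMember h0 (hY j) (iIndepFun_arm hind j)
    (interior_subset (hη j)) (interior_subset hζm) (m j)
  have hST : IndepFun S T μ := indepFun_sum_range (fun i s => (hY i s).aemeasurable) hind
    (fun h => hij.ne (by rw [h])) _ _
  have hind' : IndepFun (fun ω => (ζ - η i) * S ω) (fun ω => (ζ - η j) * T ω) μ :=
    hST.comp (φ := fun x => (ζ - η i) * x) (ψ := fun x => (ζ - η j) * x)
      (by fun_prop) (by fun_prop)
  have hS1 : Integrable (fun ω => Real.exp (1 * ((ζ - η i) * S ω))) μ := by simpa using hSi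
  have hT1 : Integrable (fun ω => Real.exp (1 * ((ζ - η j) * T ω))) μ := by simpa using hTi
  -- The tilts are already inside the two variables, so the Chernoff parameter is 1 and the
  -- threshold 0.
  have hch := measure_ge_le_exp_mul_mgf (μ := μ) 0 zero_le_one
    (hind'.integrable_exp_mul_add hS1 hT1)
  rw [hind'.mgf_add hS1.aestronglyMeasurable hT1.aestronglyMeasurable, mgf_const_mul,
    mgf_const_mul, mul_one, mul_one, hSm, hTm, mul_zero, Real.exp_zero, one_mul,
    ← Real.exp_add] at hch
  refine (measureReal_mono fun ω hω => ?_).trans (hch.trans_eq ?_)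
  · have hω' : S ω / m i ≤ T ω / m j := hω
    have hv : 0 ≤ m j * (ζ - η j) := by
      have h1 : (m i + m j : ℝ) * (ζ - η j) = m i * (η i - η j) := by linear_combination hζe
      have h2 : 0 ≤ ζ - η j := by
        by_contra hcon
        have h3 := mul_neg_of_pos_of_neg (add_pos hi' hj') (not_le.1 hcon)
        have h4 := mul_pos hi' (sub_pos.2 hij)
        linarith
      positivity
    have h5 := mul_nonneg hv (sub_nonneg.2 hω')
    show 0 ≤ (ζ - η i) * S ω + (ζ - η j) * T ω
    refine h5.trans_eq ?_
    have h6 : (m j : ℝ) * (ζ - η j) = -(m i * (ζ - η i)) := by linear_combination hζe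
    have h7 : (m j : ℝ) * (ζ - η j) * (T ω / m j) = (ζ - η j) * T ω := by field_simp
    have h8 : (m i : ℝ) * (ζ - η i) * (S ω / m i) = (ζ - η i) * S ω := by field_simp
    rw [mul_sub, h7, h6, ← h8]
    ring
  · congr 1
    rw [pairExponent, ← hζ]
    ring

/-- The level `meanOf ν ζ` separates the arms: `i` is tilted to `u < ζ`, `j` to `v > ζ`. Continuity
of the divergence costs `δ / 2` per sample and the one-arm bounds another `δ / 2`. -/
theorem NonSingular.exists_mul_exp_le_sampleMeans_lt (hν : NonSingular ν)
    (hη : ∀ i, η i ∈ interior (naturalSpace ν))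
    (hY : ∀ i s, HasLaw (Y i s) (expMember ν (η i)) μ)
    (hind : iIndepFun (fun p : Fin K × ℕ => Y p.1 p.2) μ) {i j : Fin K} (hij : i ≠ j)
    {ζ δ : ℝ} (hζ : ζ ∈ interior (naturalSpace ν)) (hδ : 0 < δ) :
    ∃ c > 0, ∀ m : Fin K → ℕ, 0 < m i → 0 < m j →
      c * Real.exp (-(m i * (klParam ν ζ (η i) + δ) + m j * (klParam ν ζ (η j) + δ))) ≤
        μ.real {ω | sampleMeans Y m ω i < sampleMeans Y m ω j} := by
  have hnear (k : Fin K) : ∀ᶠ u in 𝓝 ζ, u ∈ interior (naturalSpace ν) ∧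
      klParam ν u (η k) < klParam ν ζ (η k) + δ / 2 :=
    (isOpen_interior.eventually_mem hζ).and
      ((continuousAt_klParam_left (η k) hζ).eventually (gt_mem_nhds (by linarith)))
  obtain ⟨u, ⟨hu, hui⟩, huζ⟩ := (((hnear i).filter_mono nhdsWithin_le_nhds).and
    (eventually_mem_nhdsWithin (s := Set.Iio ζ))).exists
  obtain ⟨v, ⟨hv, hvj⟩, hvζ⟩ := (((hnear j).filter_mono nhdsWithin_le_nhds).and
    (eventually_mem_nhdsWithin (s := Set.Ioi ζ))).exists
  obtain ⟨c, hc, hcm⟩ := hν.exists_mul_exp_le_sum_lt (hY i) (iIndepFun_arm hind i)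
    (interior_subset (hη i)) hu (hν.strictMonoOn_meanOf hu hζ huζ) (half_pos hδ)
  obtain ⟨d, hd, hdm⟩ := hν.exists_mul_exp_le_lt_sum (hY j) (iIndepFun_arm hind j)
    (interior_subset (hη j)) hv (hν.strictMonoOn_meanOf hζ hv hvζ) (half_pos hδ)
  refine ⟨c * d, mul_pos hc hd, fun m hi hj => ?_⟩
  have hi' : (0 : ℝ) < m i := by exact_mod_cast hi
  have hj' : (0 : ℝ) < m j := by exact_mod_cast hj
  have hST := indepFun_sum_range (fun i s => (hY i s).aemeasurable) hind hij (m i) (m j)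
  have hprod := hST.measure_inter_preimage_eq_mul (Set.Iio (m i * meanOf ν ζ))
    (Set.Ioi (m j * meanOf ν ζ)) measurableSet_Iio measurableSet_Ioi
  calc c * d * Real.exp (-(m i * (klParam ν ζ (η i) + δ) + m j * (klParam ν ζ (η j) + δ)))
      ≤ (c * Real.exp (-(m i * (klParam ν u (η i) + δ / 2)))) *
        (d * Real.exp (-(m j * (klParam ν v (η j) + δ / 2)))) := by
        rw [mul_mul_mul_comm, ← Real.exp_add]
        gcongr
        have h1 : m i * (klParam ν u (η i) + δ / 2) ≤ m i * (klParam ν ζ (η i) + δ) := by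
          exact mul_le_mul_of_nonneg_left (by linarith) hi'.le
        have h2 : m j * (klParam ν v (η j) + δ / 2) ≤ m j * (klParam ν ζ (η j) + δ) := by
          exact mul_le_mul_of_nonneg_left (by linarith) hj'.le
        linarith
    _ ≤ _ := mul_le_mul (hcm _ hi) (hdm _ hj) (by positivity) measureReal_nonneg
    _ = μ.real ((fun ω => ∑ s ∈ Finset.range (m i), Y i s ω) ⁻¹' Set.Iio (m i * meanOf ν ζ) ∩
          (fun ω => ∑ s ∈ Finset.range (m j), Y j s ω) ⁻¹' Set.Ioi (m j * meanOf ν ζ)) := by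
        rw [measureReal_def, measureReal_def, ← ENNReal.toReal_mul]
        exact congrArg ENNReal.toReal hprod.symm
    _ ≤ _ := measureReal_mono fun ω hω => by
        have h1 : sampleMeans Y m ω i < meanOf ν ζ := (div_lt_iff₀' hi').2 hω.1
        have h2 : meanOf ν ζ < sampleMeans Y m ω j := (lt_div_iff₀' hj').2 hω.2
        exact h1.trans h2

end TwoArms

end Rewards

/-! ### Decay rates -/

lemma hasDecayRate_of_bounds {p : ℕ → ℝ} {r : ℝ}
    (hlow : ∀ δ > 0, ∃ c > 0, ∀ᶠ n : ℕ in atTop, c * Real.exp (-(n * (r + δ))) ≤ p n)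
    (hup : ∀ δ > 0, ∃ C > 0, ∀ᶠ n : ℕ in atTop, p n ≤ C * Real.exp (-(n * (r - δ)))) :
    HasDecayRate p r := by
  have hpos : ∀ᶠ n in atTop, 0 < p n := by
    obtain ⟨c, hc, h⟩ := hlow 1 one_pos
    filter_upwards [h] with n hn using lt_of_lt_of_le (by positivity) hn
  have hlim (C : ℝ) : Tendsto (fun n : ℕ => Real.log C / (n : ℝ)) atTop (𝓝 0) :=
    tendsto_const_div_atTop_nhds_zero_nat _
  refine ⟨hpos, tendsto_order.2 ⟨fun a ha => ?_, fun a ha => ?_⟩⟩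
  -- Half of the gap goes to the exponent, the other half absorbs `log C / n`.
  · have hδ : 0 < (r - a) / 2 := by linarith
    obtain ⟨C, hC, h⟩ := hup _ hδ
    filter_upwards [h, hpos, eventually_gt_atTop 0,
      (hlim C).eventually (gt_mem_nhds hδ)] with n hn hp hn0 hl
    have hn0' : (0 : ℝ) < n := by exact_mod_cast hn0
    have hlog := Real.log_le_log hp hn
    rw [Real.log_mul hC.ne' (Real.exp_pos _).ne', Real.log_exp] at hlog
    rw [div_lt_iff₀ hn0'] at hl
    rw [neg_mul, one_div_mul_eq_div, lt_neg, div_lt_iff₀ hn0']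
    nlinarith
  · have hδ : 0 < (a - r) / 2 := by linarith
    obtain ⟨c, hc, h⟩ := hlow _ hδ
    filter_upwards [h, eventually_gt_atTop 0,
      (hlim c).eventually (lt_mem_nhds (neg_lt_zero.2 hδ))] with n hn hn0 hl
    have hn0' : (0 : ℝ) < n := by exact_mod_cast hn0
    have hlog := Real.log_le_log (by positivity) hn
    rw [Real.log_mul hc.ne' (Real.exp_pos _).ne', Real.log_exp] at hlog
    rw [lt_div_iff₀ hn0'] at hl
    rw [neg_mul, one_div_mul_eq_div, neg_lt, lt_div_iff₀ hn0']
    nlinarith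

/-- Homogeneity passes from sample counts to sampling frequencies. -/
lemma pairExponent_mul (ν : Measure ℝ) {c : ℝ} (hc : c ≠ 0) (w₁ w₂ η₁ η₂ : ℝ) :
    pairExponent ν (c * w₁) (c * w₂) η₁ η₂ = c * pairExponent ν w₁ w₂ η₁ η₂ := by
  have h : mixParam (c * w₁) (c * w₂) η₁ η₂ = mixParam w₁ w₂ η₁ η₂ := by
    rw [mixParam, mixParam, ← mul_add, mul_assoc, mul_assoc, ← mul_add, mul_div_mul_left _ _ hc]
  rw [pairExponent, pairExponent, h]
  ring

lemma tendsto_pairExponent {ν : Measure ℝ} {ι : Type*} {l : Filter ι} {f g : ι → ℝ}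
    {w₁ w₂ η₁ η₂ : ℝ} (hf : Tendsto f l (𝓝 w₁)) (hg : Tendsto g l (𝓝 w₂)) (h₁ : 0 ≤ w₁)
    (h₂ : 0 ≤ w₂) (hw : 0 < w₁ + w₂) (hη₁ : η₁ ∈ interior (naturalSpace ν))
    (hη₂ : η₂ ∈ interior (naturalSpace ν)) :
    Tendsto (fun n => pairExponent ν (f n) (g n) η₁ η₂) l (𝓝 (pairExponent ν w₁ w₂ η₁ η₂)) := by
  have hmix : Tendsto (fun n => mixParam (f n) (g n) η₁ η₂) l (𝓝 (mixParam w₁ w₂ η₁ η₂)) :=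
    ((hf.mul_const _).add (hg.mul_const _)).div (hf.add hg) hw.ne'
  exact ((hf.mul_const _).add (hg.mul_const _)).sub ((hf.add hg).mul
    ((continuousAt_logPartition (mixParam_mem h₁ h₂ hw hη₁ hη₂)).tendsto.comp hmix))

section Allocation

variable {ν : Measure ℝ} {Ω : Type*} [MeasurableSpace Ω] {μ : Measure Ω}
  {K : ℕ} {Y : Fin K → ℕ → Ω → ℝ}

/-! ### Sets of best arms -/

/-- Exchanging `i` for `j` cannot increase the sum. -/
lemma IsTopSet.le_of_mem_of_notMem {k : ℕ} {x : Fin K → ℝ} {S : Finset (Fin K)}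
    (hS : IsTopSet k x S) {i j : Fin K} (hi : i ∈ S) (hj : j ∉ S) : x j ≤ x i := by
  have hj' : j ∉ S.erase i := fun h => hj (Finset.mem_of_mem_erase h)
  have h := hS.2 (insert j (S.erase i)) (by
    rw [Finset.card_insert_of_notMem hj', Finset.card_erase_add_one hi, hS.1])
  rw [Finset.sum_insert hj'] at h
  linarith [Finset.add_sum_erase S x hi]

/-- In case of a tie the exchanged set would be a second maximizer. -/
lemma IsTopSet.lt_of_mem_of_notMem {k : ℕ} {x : Fin K → ℝ} {S : Finset (Fin K)}
    (hS : IsTopSet k x S) (huniq : ∀ S', IsTopSet k x S' → S' = S) {i j : Fin K} (hi : i ∈ S)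
    (hj : j ∉ S) : x j < x i := by
  refine (hS.le_of_mem_of_notMem hi hj).lt_of_ne fun heq => hj ?_
  have hj' : j ∉ S.erase i := fun h => hj (Finset.mem_of_mem_erase h)
  have hswap : IsTopSet k x (insert j (S.erase i)) := by
    refine ⟨by rw [Finset.card_insert_of_notMem hj', Finset.card_erase_add_one hi, hS.1],
      fun S' hS' => (hS.2 S' hS').trans_eq ?_⟩
    rw [Finset.sum_insert hj', heq, Finset.add_sum_erase S x hi]
  rw [← huniq _ hswap]
  exact Finset.mem_insert_self _ _

lemma IsTopSet.eq_of_mem_topRegion {k : ℕ} {x : Fin K → ℝ} {S I : Finset (Fin K)}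
    (hS : IsTopSet k x S) (hI : I.card = k) (hx : x ∈ topRegion I) : S = I := by
  by_contra hne
  obtain ⟨j, hjS, hjI⟩ : ∃ j ∈ S, j ∉ I := by
    by_contra! h
    exact hne (Finset.eq_of_subset_of_card_le h (by rw [hI, hS.1]))
  obtain ⟨i, hiI, hiS⟩ : ∃ i ∈ I, i ∉ S := by
    by_contra! h
    exact hne (Finset.eq_of_subset_of_card_le h (by rw [hI, hS.1])).symm
  exact absurd (hS.le_of_mem_of_notMem hjS hiS)
    (not_le.2 (hx i hiI j (Finset.mem_compl.2 hjI)))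

lemma mem_compl_topRegion_iff {I : Finset (Fin K)} {x : Fin K → ℝ} :
    x ∈ (topRegion I)ᶜ ↔ ∃ i ∈ I, ∃ j ∈ Iᶜ, x i ≤ x j := by
  rw [Set.mem_compl_iff, topRegion, Set.mem_ofPred_eq]
  push Not
  rfl

lemma measurableSet_topRegion (I : Finset (Fin K)) : MeasurableSet (topRegion I) := by
  have : topRegion I = ⋂ i ∈ I, ⋂ j ∈ Iᶜ, {x : Fin K → ℝ | x j < x i} := by
    ext x; simp [topRegion]
  rw [this]
  exact Finset.measurableSet_biInter _ fun i _ => Finset.measurableSet_biInter _ fun j _ =>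
    measurableSet_lt (measurable_pi_apply j) (measurable_pi_apply i)

lemma sampleMeansLaw_real_apply (hY : ∀ i s, AEMeasurable (Y i s) μ) (m : Fin K → ℕ)
    {s : Set (Fin K → ℝ)} (hs : MeasurableSet s) :
    (sampleMeansLaw μ Y m).real s = μ.real {ω | sampleMeans Y m ω ∈ s} := by
  have hm : AEMeasurable (sampleMeans Y m) μ := by
    refine aemeasurable_pi_lambda _ fun i => ?_
    exact (Finset.aemeasurable_fun_sum _ fun s _ => hY i s).div_const _
  rw [measureReal_def, sampleMeansLaw, Measure.map_apply_of_aemeasurable hm hs]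
  rfl

/-! ### Decay rates of the comparisons -/

variable [IsProbabilityMeasure μ] {θ ψ : Fin K → ℝ} {N : ℕ → Fin K → ℕ}

theorem NonSingular.exists_mul_exp_le_pair (hν : NonSingular ν) (hθ : ∀ i, θ i ∈ meanSpace ν)
    (hY : ∀ i s, HasLaw (Y i s) (memberOfMean ν (θ i)) μ)
    (hind : iIndepFun (fun p : Fin K × ℕ => Y p.1 p.2) μ)
    (hψ : ∀ i, 0 ≤ ψ i) (hN : ∀ᶠ n in atTop, ∀ i, 0 < N n i)
    (hNψ : ∀ i, Tendsto (fun n : ℕ => (N n i : ℝ) / (n : ℝ)) atTop (𝓝 (ψ i)))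
    {i j : Fin K} (hij : i ≠ j) {δ : ℝ} (hδ : 0 < δ) :
    ∃ c > 0, ∀ᶠ n : ℕ in atTop,
      c * Real.exp (-(n * (pairRate ν (ψ i) (ψ j) (θ i) (θ j) + δ))) ≤
        μ.real {ω | sampleMeans Y (N n) ω i < sampleMeans Y (N n) ω j} := by
  obtain ⟨ζ, hζ, hr⟩ := hν.exists_mem_interior_weighted_klParam_eq_pairRate (hθ i) (hθ j)
    (hψ i) (hψ j)
  rw [← hr]
  have hψ' : 0 < ψ i + ψ j + 1 := by linarith [hψ i, hψ j]
  -- The `+ 1` makes `(ψ i + ψ j) * ε < δ` strict, which leaves room for the convergence of the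
  -- frequencies.
  set ε := δ / (ψ i + ψ j + 1) with hε
  have hε0 : 0 < ε := div_pos hδ hψ'
  have hεδ : (ψ i + ψ j + 1) * ε = δ := by rw [hε]; field_simp
  obtain ⟨c, hc, h⟩ := hν.exists_mul_exp_le_sampleMeans_lt
    (fun i => paramOf_mem (hθ i)) hY hind hij hζ hε0
  refine ⟨c, hc, ?_⟩
  have hlim := ((hNψ i).mul_const (klParam ν ζ (paramOf ν (θ i)) + ε)).add
    ((hNψ j).mul_const (klParam ν ζ (paramOf ν (θ j)) + ε))
  have hlt : ψ i * (klParam ν ζ (paramOf ν (θ i)) + ε) + ψ j * (klParam ν ζ (paramOf ν (θ j)) + ε)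
      < ψ i * klParam ν ζ (paramOf ν (θ i)) + ψ j * klParam ν ζ (paramOf ν (θ j)) + δ := by
    linarith
  filter_upwards [hN, eventually_gt_atTop 0, hlim.eventually (gt_mem_nhds hlt)] with n hn hn0 hlt
  have hn0' : (0 : ℝ) < n := by exact_mod_cast hn0
  refine le_trans ?_ (h (N n) (hn i) (hn j))
  gcongr
  have h2 := mul_le_mul_of_nonneg_left hlt.le hn0'.le
  refine le_trans (le_of_eq ?_) h2
  field_simp

theorem NonSingular.eventually_le_exp_pair (hν : NonSingular ν) (hθ : ∀ i, θ i ∈ meanSpace ν)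
    (hY : ∀ i s, HasLaw (Y i s) (memberOfMean ν (θ i)) μ)
    (hind : iIndepFun (fun p : Fin K × ℕ => Y p.1 p.2) μ)
    (hψ : ∀ i, 0 ≤ ψ i) (hN : ∀ᶠ n in atTop, ∀ i, 0 < N n i)
    (hNψ : ∀ i, Tendsto (fun n : ℕ => (N n i : ℝ) / (n : ℝ)) atTop (𝓝 (ψ i)))
    {i j : Fin K} (hij : θ j < θ i) {δ : ℝ} (hδ : 0 < δ) :
    ∀ᶠ n : ℕ in atTop,
      μ.real {ω | sampleMeans Y (N n) ω i ≤ sampleMeans Y (N n) ω j} ≤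
        Real.exp (-(n * (pairRate ν (ψ i) (ψ j) (θ i) (θ j) - δ))) := by
  rcases (add_nonneg (hψ i) (hψ j)).eq_or_lt' with hw | hw
  -- If neither arm has a positive rate, `pairRate` is 0 and the trivial bound 1 suffices.
  · have hi : ψ i = 0 := by linarith [hψ i, hψ j]
    have hj : ψ j = 0 := by linarith [hψ i, hψ j]
    obtain ⟨ζ, -, hr⟩ := hν.exists_mem_interior_weighted_klParam_eq_pairRate (hθ i) (hθ j)
      (hψ i) (hψ j)
    rw [← hr, hi, hj]
    refine Eventually.of_forall fun n => measureReal_le_one.trans (Real.one_le_exp ?_)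
    have : 0 ≤ (n : ℝ) * δ := by positivity
    linarith
  rw [hν.pairRate_eq_pairExponent (hθ i) (hθ j) (hψ i) (hψ j) hw]
  have hlim := tendsto_pairExponent (hNψ i) (hNψ j) (hψ i) (hψ j) hw (paramOf_mem (hθ i))
    (paramOf_mem (hθ j))
  filter_upwards [hN, eventually_gt_atTop 0,
    hlim.eventually (lt_mem_nhds (sub_lt_self _ hδ))] with n hn hn0 hlt
  have hn0' : (0 : ℝ) < n := by exact_mod_cast hn0
  refine (hν.measureReal_sampleMeans_le_le_exp (fun i => paramOf_mem (hθ i)) hY hind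
    (hν.paramOf_lt_paramOf (hθ j) (hθ i) hij) (hn i) (hn j)).trans ?_
  have hscale := pairExponent_mul ν hn0'.ne' ((N n i : ℝ) / n) ((N n j : ℝ) / n)
    (paramOf ν (θ i)) (paramOf ν (θ j))
  rw [mul_div_cancel₀ _ hn0'.ne', mul_div_cancel₀ _ hn0'.ne'] at hscale
  rw [hscale]
  gcongr

/-- The pair attaining the minimum gives the lower bound; the union bound loses only the factor
`I.card * J.card`. As only a sandwich on `p` is required, the same statement serves single pairs,
the ordering event and arbitrary tie-breaking. -/
theorem NonSingular.hasDecayRate_of_le_of_le (hν : NonSingular ν)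
    (hθ : ∀ i, θ i ∈ meanSpace ν) (hY : ∀ i s, HasLaw (Y i s) (memberOfMean ν (θ i)) μ)
    (hind : iIndepFun (fun p : Fin K × ℕ => Y p.1 p.2) μ)
    (hψ : ∀ i, 0 ≤ ψ i) (hN : ∀ᶠ n in atTop, ∀ i, 0 < N n i)
    (hNψ : ∀ i, Tendsto (fun n : ℕ => (N n i : ℝ) / (n : ℝ)) atTop (𝓝 (ψ i)))
    {I J : Finset (Fin K)} (hI : I.Nonempty) (hJ : J.Nonempty)
    (hIJ : ∀ i ∈ I, ∀ j ∈ J, θ j < θ i) {p : ℕ → ℝ}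
    (hlow : ∀ n, ∀ i ∈ I, ∀ j ∈ J,
      μ.real {ω | sampleMeans Y (N n) ω i < sampleMeans Y (N n) ω j} ≤ p n)
    (hup : ∀ n, p n ≤
      μ.real {ω | ∃ i ∈ I, ∃ j ∈ J, sampleMeans Y (N n) ω i ≤ sampleMeans Y (N n) ω j}) :
    HasDecayRate p
      (I.inf' hI fun i => J.inf' hJ fun j => pairRate ν (ψ i) (ψ j) (θ i) (θ j)) := by
  refine hasDecayRate_of_bounds (fun δ hδ => ?_) fun δ hδ => ?_
  · obtain ⟨i, hi, hir⟩ := Finset.exists_mem_eq_inf' hI fun i =>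
      J.inf' hJ fun j => pairRate ν (ψ i) (ψ j) (θ i) (θ j)
    obtain ⟨j, hj, hjr⟩ := Finset.exists_mem_eq_inf' hJ fun j =>
      pairRate ν (ψ i) (ψ j) (θ i) (θ j)
    rw [hir, hjr]
    obtain ⟨c, hc, h⟩ := hν.exists_mul_exp_le_pair hθ hY hind hψ hN hNψ
      (i := i) (j := j) (fun h => (hIJ i hi j hj).ne (by rw [h])) hδ
    exact ⟨c, hc, h.mono fun n hn => hn.trans (hlow n i hi j hj)⟩
  · set r := I.inf' hI fun i => J.inf' hJ fun j => pairRate ν (ψ i) (ψ j) (θ i) (θ j) with hr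
    refine ⟨I.card * J.card, mul_pos (by exact_mod_cast hI.card_pos)
      (by exact_mod_cast hJ.card_pos), ?_⟩
    have hall : ∀ᶠ n : ℕ in atTop, ∀ i ∈ I, ∀ j ∈ J,
        μ.real {ω | sampleMeans Y (N n) ω i ≤ sampleMeans Y (N n) ω j} ≤
          Real.exp (-(n * (pairRate ν (ψ i) (ψ j) (θ i) (θ j) - δ))) := by
      rw [eventually_all_finset]
      intro i hi
      rw [eventually_all_finset]
      exact fun j hj => hν.eventually_le_exp_pair hθ hY hind hψ hN hNψ (hIJ i hi j hj) hδ
    filter_upwards [hall] with n hn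
    have hset : {ω | ∃ i ∈ I, ∃ j ∈ J, sampleMeans Y (N n) ω i ≤ sampleMeans Y (N n) ω j}
        = ⋃ q ∈ I ×ˢ J, {ω | sampleMeans Y (N n) ω q.1 ≤ sampleMeans Y (N n) ω q.2} := by
      ext ω
      simp only [Set.mem_ofPred_eq, Set.mem_iUnion, Finset.mem_product, Prod.exists, exists_prop]
      grind
    refine (hup n).trans ?_
    rw [hset]
    refine (measureReal_biUnion_finset_le _ _).trans ?_
    have hterm : ∀ q ∈ I ×ˢ J,
        μ.real {ω | sampleMeans Y (N n) ω q.1 ≤ sampleMeans Y (N n) ω q.2} ≤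
          Real.exp (-(n * (r - δ))) := by
      intro q hq
      obtain ⟨hi, hj⟩ := Finset.mem_product.1 hq
      refine (hn q.1 hi q.2 hj).trans ?_
      gcongr
      exact (Finset.inf'_le _ hi).trans (Finset.inf'_le _ hj)
    refine (Finset.sum_le_card_nsmul _ _ _ hterm).trans_eq ?_
    rw [Finset.card_product, nsmul_eq_mul]
    push_cast
    ring

end Allocation

theorem mainTheorem7 {K : ℕ}
    -- the exponential family and the mean rewards
    (ν : Measure ℝ) (hν : NonSingular ν)
    (θ : Fin K → ℝ) (hθ : ∀ i, θ i ∈ meanSpace ν)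
    -- the rewards: independent, those of arm `i` have the law with mean `θ i`
    {Ω : Type*} [MeasurableSpace Ω] (μ : Measure Ω) [IsProbabilityMeasure μ]
    (Y : Fin K → ℕ → Ω → ℝ)
    (hY : ∀ i s, HasLaw (Y i s) (memberOfMean ν (θ i)) μ)
    (hind : iIndepFun (fun p : Fin K × ℕ => Y p.1 p.2) μ)
    -- the static allocation: with budget `n`, arm `i` gets `N n i` samples
    (ψ : Fin K → ℝ) (hψ : ψ ∈ stdSimplex ℝ (Fin K))
    (N : ℕ → Fin K → ℕ) (hN : ∀ᶠ n in atTop, ∀ i, 0 < N n i)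
    (hNψ : ∀ i, Tendsto (fun n : ℕ => (N n i : ℝ) / (n : ℝ)) atTop (𝓝 (ψ i))) :
    (∀ i j, θ j < θ i →
      HasDecayRate (fun n => (sampleMeansLaw μ Y (N n)).real {x | x i < x j})
        (pairRate ν (ψ i) (ψ j) (θ i) (θ j)) ∧
      (0 < ψ i + ψ j →
        ∃! x, x ∈ meanSpace ν ∧
          IsMinOn (pairCost ν (ψ i) (ψ j) (θ i) (θ j)) (meanSpace ν) x)) ∧
    (∀ (k : ℕ) (I : Finset (Fin K)) (hI : I.Nonempty) (hJ : Iᶜ.Nonempty),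
      IsTopSet k θ I → (∀ S, IsTopSet k θ S → S = I) →
      HasDecayRate (fun n => (sampleMeansLaw μ Y (N n)).real (topRegion I)ᶜ)
        (I.inf' hI fun i => Iᶜ.inf' hJ fun j => pairRate ν (ψ i) (ψ j) (θ i) (θ j)) ∧
      ∀ R : ℕ → Ω → Finset (Fin K),
        (∀ n ω, IsTopSet k (sampleMeans Y (N n) ω) (R n ω)) →
        HasDecayRate (fun n => μ.real {ω | R n ω ≠ I})
          (I.inf' hI fun i => Iᶜ.inf' hJ fun j => pairRate ν (ψ i) (ψ j) (θ i) (θ j))) := by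
  have hYm : ∀ i s, AEMeasurable (Y i s) μ := fun i s => (hY i s).aemeasurable
  refine ⟨fun i j hij => ⟨?_, hν.existsUnique_isMinOn_pairCost (hθ i) (hθ j) (hψ.1 i) (hψ.1 j)⟩,
    fun k I hI hJ hItop huniq => ?_⟩
  · have h := hν.hasDecayRate_of_le_of_le hθ hY hind hψ.1 hN hNψ (Finset.singleton_nonempty i)
      (Finset.singleton_nonempty j) (by simpa using hij)
      (p := fun n => (sampleMeansLaw μ Y (N n)).real {x | x i < x j}) (fun n a ha b hb => ?_)
      fun n => ?_
    · simpa using h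
    · obtain rfl := Finset.mem_singleton.1 ha
      obtain rfl := Finset.mem_singleton.1 hb
      exact (sampleMeansLaw_real_apply hYm _
        (measurableSet_lt (measurable_pi_apply a) (measurable_pi_apply b))).ge
    · rw [sampleMeansLaw_real_apply hYm _
        (measurableSet_lt (measurable_pi_apply i) (measurable_pi_apply j))]
      exact measureReal_mono fun ω hω =>
        ⟨i, Finset.mem_singleton_self i, j, Finset.mem_singleton_self j, le_of_lt hω⟩
  · have hIJ : ∀ i ∈ I, ∀ j ∈ Iᶜ, θ j < θ i := fun i hi j hj =>
      hItop.lt_of_mem_of_notMem huniq hi (Finset.mem_compl.1 hj)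
    -- For `R` only monotonicity of `μ` on arbitrary sets is used, so its measurability plays no
    -- role.
    refine ⟨hν.hasDecayRate_of_le_of_le hθ hY hind hψ.1 hN hNψ hI hJ hIJ (fun n i hi j hj => ?_)
      fun n => ?_, fun R hR => hν.hasDecayRate_of_le_of_le hθ hY hind hψ.1 hN hNψ hI hJ hIJ
      (fun n i hi j hj => measureReal_mono fun ω hω => ?_)
      fun n => measureReal_mono fun ω hω => ?_⟩
    · rw [sampleMeansLaw_real_apply hYm _ (measurableSet_topRegion I).compl]
      exact measureReal_mono fun ω hω =>
        mem_compl_topRegion_iff.2 ⟨i, hi, j, hj, le_of_lt hω⟩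
    · rw [sampleMeansLaw_real_apply hYm _ (measurableSet_topRegion I).compl]
      exact measureReal_mono fun ω hω => mem_compl_topRegion_iff.1 hω
    -- A strict inversion rules out `I` however ties are broken.
    · rintro (rfl : R n ω = I)
      exact absurd ((hR n ω).le_of_mem_of_notMem hi (Finset.mem_compl.1 hj)) (not_le.2 hω)
    · refine mem_compl_topRegion_iff.1 fun hmem => hω ?_
      exact (hR n ω).eq_of_mem_topRegion hItop.1 hmem
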